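/- Let $n\ge 1$, $[n]=\{1,\dots,n\}$ and $r\in[n]$. Let $\mathcal T_n$ be the set of (unrooted) trees with vertex set $[n]$, and $\mathcal T_n^{(r)}$ the set of trees with vertex set $[n]$ rooted at $r$. The local orientation of a tree orients an edge $\{i,j\}$ with $i<j$ as $i\to j$, toward its larger vertex; the global orientation of a rooted tree orients every edge toward the root, from child to parent. The indegree sequence of an oriented tree is the multiset of its positive indegrees, a partition of $n-1$. For a partition $\lambda$ of $n-1$, let $\mathcal T_{n,\lambda}\subseteq\mathcal T_n$ and $\mathcal T_{n,\lambda}^{(r)}\subseteq\mathcal T_n^{(r)}$ be the sets of trees whose local, respectively global, indegree sequence is $\lambda$. In a tree rooted at $r$ (or an unrooted tree hung up at $r$), label each edge by its child endpoint. The local sibship $\mathrm{sib}_{loc}^{(r)}(T;v)$ (global sibship $\mathrm{sib}_{glo}^{(r)}(T;v)$) is the set of the labels of the edges which are locally (globally) oriented toward $v$. For $T\in\mathcal T_n$ let $\phi_{loc}(T)$ be the partition of $[n]\setminus\{r\}$ whose blocks are the nonempty local sibships of $T$ hung up at $r$; for $T'\in\mathcal T_n^{(r)}$ let $\phi_{glo}(T')$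 be the partition whose blocks are the nonempty sets of children of the vertices of $T'$. For $T\in\mathcal T_n$ define a permutation $\sigma=\sigma_T$ of $[n]$ and a graph $\Phi_r(T)$ as follows. Hang $T$ up at $r$ and call an edge from a child $i$ to its parent $j$ good if $i<j$ and bad if $i>j$. Remove the good edges; each remaining component is a tree with increasing labels away from its root, the vertex nearest to $r$. List the vertices of each component in postorder $v_1,\dots,v_l$ (the subtrees at the children of a vertex are listed in increasing order of these children, and then the vertex itself). Let $\sigma$ be the product of the cycles $(v_1,\dots,v_l)$, $v_1\mapsto v_2\mapsto\cdots\mapsto v_l\mapsto v_1$, over all components. The edges of $\Phi_r(T)$ are the edges $v_1\to v_2\to\cdots\to v_l$ for every component, and the edges $i\to\sigma(j)$ for every good edge $i\to j$; its root is $r$. Theorem. $\Phi_r$ is a bijection from $\mathcal T_n$ to $\mathcal T_n^{(r)}$. For every $T\in\mathcal T_n$ the local indegree sequence of $T$ equals the global indegree sequence of $\Phi_r(T)$; thus, for every partition $\lambda$ of $n-1$, $\Phi_r$ restricts to a bijection from $\mathcal T_{n,\lambda}$ to $\mathcal T_{n,\lambda}^{(r)}$. Moreover, for every $T\in\mathcal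 T_n$ and every vertex $v$, $$\mathrm{sib}_{loc}^{(r)}(T;v)=\mathrm{sib}_{glo}^{(r)}(\Phi_r(T);\sigma_T(v)),$$ and therefore $\phi_{loc}(T)=\phi_{glo}(\Phi_r(T))$. -/

import Mathlib

namespace TreeBijection

/-- A graph with a distinguished vertex, its root. -/
@[ext]
structure RootedGraph (V : Type*) where
  graph : SimpleGraph V
  root : V

/-- The (unrooted) trees with vertex set `V`. -/
def labeledTrees (V : Type*) : Set (SimpleGraph V) := {T | T.IsTree}

/-- The trees with vertex set `V` that are rooted at `r`. -/
def rootedTrees {V : Type*} (r : V) : Set (RootedGraph V) :=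
  {T | T.graph.IsTree ∧ T.root = r}

/-- Local orientation: an edge `{i, j}` with `i < j` is oriented `i → j`. -/
def LocArc {V : Type*} [LinearOrder V] (T : SimpleGraph V) (i j : V) : Prop :=
  T.Adj i j ∧ i < j

/-- Global orientation: every edge is oriented toward the root, that is, from its endpoint
farther from the root (the child) to its endpoint nearer to the root (the parent). -/
def GloArc {V : Type*} (T : RootedGraph V) (i j : V) : Prop :=
  T.graph.Adj i j ∧ T.graph.dist i T.root = T.graph.dist j T.root + 1

/-! ### Indegree sequences -/

/-- The number of arcs of the orientation `R` that point to `v`. -/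
noncomputable def indegree {V : Type*} (R : V → V → Prop) (v : V) : ℕ :=
  Set.ncard {w | R w v}

/-- The indegree sequence `1^{e₁} 2^{e₂} ⋯`, as the multiset of the positive indegrees. -/
noncomputable def indegreeSeq {V : Type*} [Fintype V] (R : V → V → Prop) : Multiset ℕ :=
  ((Finset.univ : Finset V).val.map (indegree R)).filter (fun k => 0 < k)

/-- The trees on `[n]` with local indegree sequence `lam`. -/
def labeledTreesOfType {n : ℕ} (lam : (n - 1).Partition) : Set (SimpleGraph (Fin n)) :=
  {T | T ∈ labeledTrees (Fin n) ∧ indegreeSeq (LocArc T) = lam.parts}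

/-- The trees on `[n]` rooted at `r` with global indegree sequence `lam`. -/
def rootedTreesOfType {n : ℕ} (r : Fin n) (lam : (n - 1).Partition) :
    Set (RootedGraph (Fin n)) :=
  {T | T ∈ rootedTrees r ∧ indegreeSeq (GloArc T) = lam.parts}

/-! ### Sibships -/

/-- In a rooted tree `T`, an edge is labeled by its child. If the edges of `T` are oriented by
`R`, the sibship of `v` is the set of the labels of the edges that `R` points to `v`. -/
def sibship {V : Type*} (T : RootedGraph V) (R : V → V → Prop) (v : V) : Set V :=
  {k | ∃ u w, GloArc T k u ∧ R w v ∧ s(k, u) = s(w, v)}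

/-- The sibship of `v` for the local orientation of the tree `T` hung up at `r`. -/
def sibshipLoc {V : Type*} [LinearOrder V] (r : V) (T : SimpleGraph V) (v : V) : Set V :=
  sibship ⟨T, r⟩ (LocArc T) v

/-- The sibship of `v` for the global orientation of the rooted tree `T`. -/
def sibshipGlo {V : Type*} (T : RootedGraph V) (v : V) : Set V :=
  sibship T (GloArc T) v

/-- The set partition `φ_loc(T)` of `V \ {r}`, as the set of its blocks: two edge labels are in
the same block iff their edges are locally oriented toward the same vertex. -/
def phiLoc {V : Type*} [LinearOrder V] (r : V) (T : SimpleGraph V) : Set (Set V) :=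
  {B | B.Nonempty ∧ ∃ v, B = sibshipLoc r T v}

/-- The set of all children of `v`. -/
def childGroup {V : Type*} (T : RootedGraph V) (v : V) : Set V := {w | GloArc T w v}

/-- The set partition `φ_glo(T)`: the set of all (nonempty) child-groups. -/
def phiGlo {V : Type*} (T : RootedGraph V) : Set (Set V) :=
  {B | B.Nonempty ∧ ∃ v, B = childGroup T v}

/-! ### Construction of the map `Φ_r` -/

section Construction

variable {V : Type*} [Fintype V] [LinearOrder V]

/-- `T` hung up at `r` has a good edge from the child `i` to the parent `j`: the local
orientation points toward the root. -/
def GoodArc (r : V) (T : SimpleGraph V) (i j : V) : Prop :=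
  GloArc ⟨T, r⟩ i j ∧ LocArc T i j

/-- `T` hung up at `r` has a bad edge from the child `i` to the parent `j`: the local
orientation points away from the root. -/
def BadArc (r : V) (T : SimpleGraph V) (i j : V) : Prop :=
  GloArc ⟨T, r⟩ i j ∧ LocArc T j i

/-- The roots of the increasing trees, that is, of the components left when the good edges
are removed from `T` hung up at `r`. -/
def IsIncreasingRoot (r : V) (T : SimpleGraph V) (v : V) : Prop :=
  v = r ∨ ∃ j, GoodArc r T v j

open scoped Classical in
/-- The children of `v` in its increasing tree. -/
noncomputable def badChildren (r : V) (T : SimpleGraph V) (v : V) : Finset V :=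
  Finset.univ.filter (fun w => BadArc r T w v)

theorem lt_of_mem_badChildren {r : V} {T : SimpleGraph V} {v w : V}
    (h : w ∈ badChildren r T v) : v < w := by
  classical
  simp only [badChildren, Finset.mem_filter] at h
  exact h.2.2.2

/-- Postorder of the part of an increasing tree that hangs at `v`: the postorders of the
subtrees at the children of `v`, the children taken in increasing order, followed by `v`. -/
noncomputable def postorder (r : V) (T : SimpleGraph V) (v : V) : List V :=
  (((badChildren r T v).sort).attach.flatMap fun w => postorder r T w.1) ++ [v]
termination_by (Finset.univ.filter (fun x : V => v < x)).card
decreasing_by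
  have hw : v < w.1 := lt_of_mem_badChildren ((Finset.mem_sort _).1 w.2)
  apply Finset.card_lt_card
  rw [Finset.ssubset_iff_of_subset]
  · exact ⟨w.1, by simpa using hw, by simp⟩
  · intro x hx
    simp only [Finset.mem_filter, Finset.mem_univ, true_and] at hx ⊢
    exact hw.trans hx

open scoped Classical in
/-- The permutation `σ`: the product, over the increasing trees, of the cyclic permutations
`(v₁, …, v_l)`, where `v₁, …, v_l` is the postorder of the increasing tree. -/
noncomputable def sigma (r : V) (T : SimpleGraph V) : Equiv.Perm V :=
  (((Finset.univ.filter (fun v => IsIncreasingRoot r T v)).sort).map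
    (fun v => (postorder r T v).formPerm)).prod

/-- The arcs `v₁ → v₂ → ⋯ → v_l` of the linear trees, where `v₁, …, v_l` is the postorder of an
increasing tree. -/
def LinearArc (r : V) (T : SimpleGraph V) (i j : V) : Prop :=
  ∃ v, IsIncreasingRoot r T v ∧ [i, j] <:+: postorder r T v

/-- The arcs `i → σ(j)`, where `i → j` is a good edge. -/
def MovedArc (r : V) (T : SimpleGraph V) (i j : V) : Prop :=
  ∃ k, GoodArc r T i k ∧ j = sigma r T k

/-- The map `Φ_r`: the linear trees are connected by the moved good edges, and the result is
rooted at `r`. -/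
def Phi (r : V) (T : SimpleGraph V) : RootedGraph V where
  graph := SimpleGraph.fromRel (fun i j => LinearArc r T i j ∨ MovedArc r T i j)
  root := r

end Construction

end TreeBijection

/-! On a non-last vertex of a linear tree the successor is its `sigma`-image, so every arc of `Phi r
T` ends at some `sigma r T v`, and the arcs ending there come from the good children of `v`, plus
`v` itself if the edge above `v` is bad (`gloArc_phi_sigma`). These are exactly the edge labels in
the local sibship of `v` (`mem_sibshipLoc`), which gives the sibship statement; indegrees are then
matched vertex by vertex along `sigma`.

The arcs are functional and lead to `r`, so they are the parent relation of a tree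
(`isTree_fromRel`).

For injectivity, `T` is recovered from its image. Going outward from `r`, a vertex below `u` is a
non-root of its increasing tree iff it is the largest child of `u` and exceeds the root of the
increasing tree of `u` (`not_isIncreasingRoot_iff`). This fixes the increasing trees as vertex sets,
then `sigma`, then the bad edges (a parent is the first smaller vertex on the `sigma`-orbit) and the
good ones. Surjectivity is by counting: fixing the root makes both sides equinumerous. -/

namespace TreeBijection

/-! ### Rooted trees as functional parent relations -/

section RootedTrees

variable {V : Type*}

theorem GloArc.ne_root {T : RootedGraph V} {i j : V} (h : GloArc T i j) : i ≠ T.root := by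
  rintro rfl
  have := h.2
  simp at this

theorem GloArc.asymm {T : RootedGraph V} {i j : V} (h : GloArc T i j) : ¬ GloArc T j i := by
  intro h'
  have := h.2
  have := h'.2
  omega

/-- A vertex of a rooted tree has at most one parent. -/
theorem GloArc.parent_unique {T : RootedGraph V} (hT : T.graph.IsTree) {i j k : V}
    (hj : GloArc T i j) (hk : GloArc T i k) : j = k := by
  obtain ⟨p, hp⟩ := hT.connected.exists_walk_length_eq_dist j T.root
  obtain ⟨q, hq⟩ := hT.connected.exists_walk_length_eq_dist k T.root
  have hp' : (SimpleGraph.Walk.cons hj.1 p).IsPath :=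
    SimpleGraph.Walk.isPath_of_length_eq_dist _ (by simp [hp, hj.2])
  have hq' : (SimpleGraph.Walk.cons hk.1 q).IsPath :=
    SimpleGraph.Walk.isPath_of_length_eq_dist _ (by simp [hq, hk.2])
  -- Both geodesics are the unique path from `i` to the root, so their second vertices agree.
  have h := (hT.isAcyclic.subsingleton_path i T.root).elim ⟨_, hp'⟩ ⟨_, hq'⟩
  have h' := congrArg SimpleGraph.Walk.snd (congrArg Subtype.val h)
  simpa using h'

theorem exists_gloArc {T : RootedGraph V} (hT : T.graph.Connected) {i : V} (hi : i ≠ T.root) :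
    ∃ j, GloArc T i j := by
  obtain ⟨p, hp⟩ := hT.exists_walk_length_eq_dist i T.root
  cases p with
  | nil => exact absurd rfl hi
  | @cons _ j _ h p =>
    refine ⟨j, h, ?_⟩
    have h1 := SimpleGraph.dist_le p
    have h2 := h.diff_dist_adj (u := T.root)
    rw [SimpleGraph.dist_comm, SimpleGraph.dist_comm (v := i)] at h2
    simp only [SimpleGraph.Walk.length_cons] at hp
    omega

theorem adj_iff_gloArc {T : RootedGraph V} (hT : T.graph.IsTree) {i j : V} :
    T.graph.Adj i j ↔ GloArc T i j ∨ GloArc T j i := by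
  refine ⟨fun h => ?_, fun h => h.elim (·.1) (·.1.symm)⟩
  have := hT.dist_eq_dist_add_one_of_adj T.root h
  simp only [SimpleGraph.dist_comm (u := T.root)] at this
  exact this.imp (fun hd => ⟨h, hd⟩) (fun hd => ⟨h.symm, hd⟩)

/-- If the arcs of `R` form a forest in which `r` is the only vertex without a parent, there is
a height function for it. -/
theorem exists_height {R : V → V → Prop} {r : V} (hr : ∀ j, ¬ R r j)
    (huniq : ∀ {i j k}, R i j → R i k → j = k) (hreach : ∀ v, Relation.ReflTransGen R v r) :
    ∃ h : V → ℕ, h r = 0 ∧ ∀ i j, R i j → h i = h j + 1 := by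
  -- The height will be the length of an `R`-path to `r`; it is unique because steps are forced and
  -- none leaves `r`.
  have key : ∀ v, ∃! k : ℕ, ∃ f : ℕ → V, f 0 = v ∧ f k = r ∧ ∀ m < k, R (f m) (f (m + 1)) := by
    intro v
    induction hreach v using Relation.ReflTransGen.head_induction_on with
    | refl =>
      refine ⟨0, ⟨fun _ => r, rfl, rfl, by simp⟩, ?_⟩
      rintro k ⟨f, h0, -, hf⟩
      by_contra hk
      exact hr _ (h0 ▸ hf 0 (Nat.pos_of_ne_zero hk))
    | @head a b hab _ ih =>
      obtain ⟨k, ⟨f, h0, hk, hf⟩, hu⟩ := ih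
      refine ⟨k + 1, ⟨fun m => Nat.casesOn m a f, rfl, hk, ?_⟩, ?_⟩
      · rintro (_ | m) hm
        · simpa [h0] using hab
        · exact hf m (by omega)
      · rintro (_ | l) ⟨g, g0, gl, hg⟩
        · exact absurd hab (by rw [← g0, gl]; exact hr b)
        · have h1 := hg 0 (by omega)
          rw [g0] at h1
          rw [hu l ⟨fun m => g (m + 1), huniq h1 hab, gl, fun m hm => hg (m + 1) (by omega)⟩]
  choose h hh hu using key
  refine ⟨h, (hu r 0 ⟨fun _ => r, rfl, rfl, by simp⟩).symm, fun i j hij => ?_⟩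
  obtain ⟨f, h0, hk, hf⟩ := hh j
  refine (hu i (h j + 1) ⟨fun m => Nat.casesOn m i f, rfl, hk, ?_⟩).symm
  rintro (_ | m) hm
  · simpa [h0] using hij
  · exact hf m (by omega)

variable [Finite V]

/-- A functional relation along which every vertex reaches `r` is the parent relation of a tree
rooted at `r`. -/
theorem isTree_fromRel {R : V → V → Prop} {r : V} (hr : ∀ j, ¬ R r j)
    (huniq : ∀ {i j k}, R i j → R i k → j = k) (hreach : ∀ v, Relation.ReflTransGen R v r) :
    (SimpleGraph.fromRel R).IsTree ∧
      ∀ i j, GloArc ⟨SimpleGraph.fromRel R, r⟩ i j ↔ R i j := by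
  obtain ⟨h, h0, hh⟩ := exists_height hr huniq hreach
  have hadj : ∀ i j, (SimpleGraph.fromRel R).Adj i j ↔ R i j ∨ R j i := by
    intro i j
    rw [SimpleGraph.fromRel_adj]
    refine ⟨And.right, fun hij => ⟨?_, hij⟩⟩
    rintro rfl
    have := hh i i (or_self_iff.1 hij)
    omega
  have hwalk : ∀ v, ∃ p : (SimpleGraph.fromRel R).Walk v r, p.length = h v := by
    intro v
    induction hreach v using Relation.ReflTransGen.head_induction_on with
    | refl => exact ⟨.nil, by simp [h0]⟩
    | @head a b hab _ ih =>
      obtain ⟨p, hp⟩ := ih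
      exact ⟨.cons ((hadj a b).2 (.inl hab)) p, by simp [hp, hh a b hab]⟩
  have hconn : (SimpleGraph.fromRel R).Connected :=
    { preconnected := fun u v => (hwalk u).choose.reachable.trans (hwalk v).choose.reachable.symm
      nonempty := ⟨r⟩ }
  -- An edge changes the height by exactly one, so no walk to `r` beats the one along `R`.
  have hle : ∀ u v, ∀ p : (SimpleGraph.fromRel R).Walk u v, h u ≤ p.length + h v := by
    intro u v p
    induction p with
    | nil => simp
    | @cons a b _ hab p ih =>
      rw [SimpleGraph.Walk.length_cons]
      rcases (hadj _ _).1 hab with h' | h' <;> have := hh _ _ h' <;> omega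
  have hdist : ∀ v, (SimpleGraph.fromRel R).dist v r = h v := by
    intro v
    obtain ⟨p, hp⟩ := hwalk v
    obtain ⟨q, hq⟩ := hconn.exists_walk_length_eq_dist v r
    have := SimpleGraph.dist_le p
    have := hle _ _ q
    omega
  refine ⟨?_, fun i j => ?_⟩
  · rw [SimpleGraph.isTree_iff_connected_and_card]
    refine ⟨hconn, le_antisymm ?_ hconn.card_vert_le_card_edgeSet_add_one⟩
    have hpar : ∀ v : {v : V // v ≠ r}, ∃ w, R v w := by
      rintro ⟨v, hv⟩
      rcases Relation.ReflTransGen.cases_head (hreach v) with h' | ⟨w, hw, -⟩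
      · exact absurd h' hv
      · exact ⟨w, hw⟩
    choose q hq using hpar
    -- Each edge joins a non-root vertex to its parent, so there are at most `Nat.card V - 1` edges;
    -- with connectedness this makes the graph a tree.
    have hsurj : Function.Surjective (fun v : {v : V // v ≠ r} =>
        (⟨s(v.1, q v), (hadj _ _).2 (.inl (hq v))⟩ : (SimpleGraph.fromRel R).edgeSet)) := by
      rintro ⟨e, he⟩
      induction e using Sym2.ind with
      | _ x y =>
        have hne : ∀ {x y}, R x y → x ≠ r := by
          rintro x y hxy rfl
          exact hr _ hxy
        rcases (hadj _ _).1 he with h' | h'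
        · exact ⟨⟨x, hne h'⟩, by simp [huniq (hq ⟨x, hne h'⟩) h']⟩
        · exact ⟨⟨y, hne h'⟩, by simp [huniq (hq ⟨y, hne h'⟩) h', Sym2.eq_swap]⟩
    have hcard := Nat.card_le_card_of_surjective _ hsurj
    have hsub : Nat.card {v : V // v ≠ r} + 1 = Nat.card V := by
      classical
      have := Fintype.ofFinite V
      have : 0 < Fintype.card V := Fintype.card_pos_iff.2 ⟨r⟩
      simp only [Nat.card_eq_fintype_card, ne_eq, Fintype.card_subtype_compl,
        Fintype.card_unique]
      omega
    exact hsub ▸ Nat.succ_le_succ hcard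
  · simp only [GloArc, hdist, hadj]
    constructor
    · rintro ⟨h' | h', h''⟩
      · exact h'
      · have := hh _ _ h'
        omega
    · exact fun h' => ⟨.inl h', hh _ _ h'⟩

end RootedTrees

theorem sibshipGlo_eq_childGroup {V : Type*} (T : RootedGraph V) (v : V) :
    sibshipGlo T v = childGroup T v := by
  ext k
  constructor
  · rintro ⟨u, w, h1, h2, h3⟩
    rcases Sym2.eq_iff.1 h3 with ⟨rfl, rfl⟩ | ⟨rfl, rfl⟩
    · exact h1
    · exact absurd h1 h2.asymm
  · exact fun h => ⟨v, k, h, h, rfl⟩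

theorem rootedTrees_eq_image {V : Type*} (r : V) :
    rootedTrees r = (fun T => RootedGraph.mk T r) '' labeledTrees V := by
  ext ⟨G, s⟩
  simp only [rootedTrees, labeledTrees, Set.mem_ofPred_eq, Set.mem_image, RootedGraph.mk.injEq]
  constructor
  · rintro ⟨hG, rfl⟩
    exact ⟨G, hG, rfl, rfl⟩
  · rintro ⟨T, hT, rfl, rfl⟩
    exact ⟨hT, rfl⟩

/-! ### Increasing trees and their postorders -/

section Postorder

open Relation

variable {V : Type*} [LinearOrder V] {r : V} {T : SimpleGraph V}

theorem BadArc.lt {i j : V} (h : BadArc r T i j) : j < i := h.2.2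

theorem GoodArc.lt {i j : V} (h : GoodArc r T i j) : i < j := h.2.2

theorem BadArc.unique (hT : T.IsTree) {i j k : V} (hj : BadArc r T i j) (hk : BadArc r T i k) :
    j = k :=
  GloArc.parent_unique (T := ⟨T, r⟩) hT hj.1 hk.1

theorem GoodArc.unique (hT : T.IsTree) {i j k : V} (hj : GoodArc r T i j)
    (hk : GoodArc r T i k) : j = k :=
  GloArc.parent_unique (T := ⟨T, r⟩) hT hj.1 hk.1

theorem BadArc.not_isIncreasingRoot (hT : T.IsTree) {i j : V} (h : BadArc r T i j) :
    ¬ IsIncreasingRoot r T i := by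
  rintro (rfl | ⟨k, hk⟩)
  · exact h.1.ne_root rfl
  · obtain rfl := GloArc.parent_unique (T := ⟨T, r⟩) hT h.1 hk.1
    exact lt_asymm h.lt hk.lt

theorem exists_badArc (hT : T.IsTree) {i : V} (h : ¬ IsIncreasingRoot r T i) :
    ∃ j, BadArc r T i j := by
  simp only [IsIncreasingRoot, not_or, not_exists] at h
  obtain ⟨j, hj⟩ := exists_gloArc (T := ⟨T, r⟩) hT.connected h.1
  refine ⟨j, hj, hj.1.symm, ?_⟩
  rcases lt_trichotomy i j with h' | rfl | h'
  · exact absurd ⟨hj, hj.1, h'⟩ (h.2 j)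
  · exact absurd rfl hj.1.ne
  · exact h'

theorem reflTransGen_badArc_le {i j : V} (h : ReflTransGen (BadArc r T) i j) : j ≤ i := by
  induction h with
  | refl => exact le_rfl
  | tail _ h ih => exact h.lt.le.trans ih

theorem eq_of_reflTransGen_badArc (hT : T.IsTree) {c d : V} (hc : IsIncreasingRoot r T c)
    (h : ReflTransGen (BadArc r T) c d) : c = d := by
  rcases h.cases_head with h | ⟨w, hw, -⟩
  · exact h
  · exact absurd hc (hw.not_isIncreasingRoot hT)

/-- Every vertex lies in an increasing tree. -/
theorem exists_increasingRoot (hT : T.IsTree) (v : V) :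
    ∃ c, IsIncreasingRoot r T c ∧ ReflTransGen (BadArc r T) v c := by
  induction h : T.dist v r using Nat.strong_induction_on generalizing v with
  | _ n ih =>
    by_cases hv : IsIncreasingRoot r T v
    · exact ⟨v, hv, .refl⟩
    · obtain ⟨p, hp⟩ := exists_badArc hT hv
      have hd : T.dist v r = T.dist p r + 1 := hp.1.2
      obtain ⟨c, hc, hpc⟩ := ih _ (by omega) p rfl
      exact ⟨c, hc, hpc.head hp⟩

/-- Bad arcs are functional, so two chains from `v` are comparable, and no bad arc leaves `c` or
`d`. -/
theorem increasingRoot_unique (hT : T.IsTree) {v c d : V} (hc : IsIncreasingRoot r T c)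
    (hd : IsIncreasingRoot r T d) (hvc : ReflTransGen (BadArc r T) v c)
    (hvd : ReflTransGen (BadArc r T) v d) : c = d := by
  rcases hvc.total_of_right_unique (fun _ _ _ h h' => h.unique hT h') hvd with h | h
  · exact eq_of_reflTransGen_badArc hT hc h
  · exact (eq_of_reflTransGen_badArc hT hd h).symm

theorem reflTransGen_badArc_dist_le {i j : V} (h : ReflTransGen (BadArc r T) i j) :
    T.dist j r ≤ T.dist i r := by
  induction h with
  | refl => exact le_rfl
  | tail _ h ih =>
    have : T.dist _ r = T.dist _ r + 1 := h.1.2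
    omega

/-- An edge pointing locally to `v` is either good and below `v`, labeled by the child, or bad and
above `v`, labeled by `v` itself. -/
theorem mem_sibshipLoc (hT : T.IsTree) {k v : V} :
    k ∈ sibshipLoc r T v ↔ GoodArc r T k v ∨ (k = v ∧ ¬ IsIncreasingRoot r T v) := by
  constructor
  · rintro ⟨u, w, h1, h2, h3⟩
    rcases Sym2.eq_iff.1 h3 with ⟨rfl, rfl⟩ | ⟨rfl, rfl⟩
    · exact .inl ⟨h1, h2⟩
    · exact .inr ⟨rfl, BadArc.not_isIncreasingRoot hT ⟨h1, h2⟩⟩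
  · rintro (h | ⟨rfl, h⟩)
    · exact ⟨v, k, h.1, h.2, rfl⟩
    · obtain ⟨p, hp⟩ := exists_badArc hT h
      exact ⟨p, p, hp.1, hp.2, Sym2.eq_swap⟩

variable [Fintype V]

theorem mem_badChildren {v w : V} : w ∈ badChildren r T v ↔ BadArc r T w v := by
  simp [badChildren]

theorem postorder_eq (v : V) :
    postorder r T v = ((badChildren r T v).sort).flatMap (postorder r T) ++ [v] := by
  rw [postorder]
  simp

theorem mem_postorder {v x : V} :
    x ∈ postorder r T v ↔ ReflTransGen (BadArc r T) x v := by
  induction v using WellFoundedGT.induction generalizing x with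
  | _ v ih =>
    rw [postorder_eq]
    simp only [List.mem_append, List.mem_flatMap, Finset.mem_sort, mem_badChildren,
      List.mem_singleton]
    rw [ReflTransGen.cases_tail_iff]
    constructor
    · rintro (⟨w, hw, hx⟩ | rfl)
      · exact .inr ⟨w, (ih w hw.lt).1 hx, hw⟩
      · exact .inl rfl
    · rintro (rfl | ⟨w, hx, hw⟩)
      · exact .inr rfl
      · exact .inl ⟨w, hw, (ih w hw.lt).2 hx⟩

theorem nodup_postorder (hT : T.IsTree) (v : V) : (postorder r T v).Nodup := by
  induction v using WellFoundedGT.induction with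
  | _ v ih =>
    rw [postorder_eq, List.nodup_append]
    refine ⟨List.nodup_flatMap.2 ⟨fun w hw => ?_, ?_⟩, by simp, ?_⟩
    · rw [Finset.mem_sort, mem_badChildren] at hw
      exact ih w hw.lt
    · refine (List.Pairwise.and_mem.1 (Finset.sort_nodup _ _)).imp ?_
      rintro w w' ⟨hw, hw', hne⟩ x hx hx'
      rw [Finset.mem_sort, mem_badChildren] at hw hw'
      rw [mem_postorder] at hx hx'
      -- A nontrivial chain from `a` to `b` passes through `v`, after which labels are at most `v <
      -- b`.
      have key : ∀ {a b : V}, BadArc r T a v → BadArc r T b v →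
          ReflTransGen (BadArc r T) a b → a = b := by
        intro a b ha hb hab
        rcases hab.cases_head with h | ⟨u, hau, hub⟩
        · exact h
        · obtain rfl := hau.unique hT ha
          exact absurd hb.lt (reflTransGen_badArc_le hub).not_gt
      rcases hx.total_of_right_unique (fun _ _ _ h h' => h.unique hT h') hx' with h | h
      · exact hne (key hw hw' h)
      · exact hne (key hw' hw h).symm
    · intro a ha b hb
      simp only [List.mem_flatMap, Finset.mem_sort, mem_badChildren] at ha
      obtain ⟨w, hw, haw⟩ := ha
      rw [List.mem_singleton.1 hb]
      exact (hw.lt.trans_le (reflTransGen_badArc_le (mem_postorder.1 haw))).ne'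

/-- In postorder, the parent of a vertex `x` is the first vertex after `x` that is smaller
than `x`. -/
theorem exists_infix_postorder {x p : V} (hxp : BadArc r T x p) {v : V}
    (hp : ReflTransGen (BadArc r T) p v) :
    ∃ B, x :: B ++ [p] <:+: postorder r T v ∧ ∀ b ∈ B, x < b := by
  induction hp with
  | refl =>
    have hx : x ∈ (badChildren r T p).sort := by
      rwa [Finset.mem_sort, mem_badChildren]
    obtain ⟨l₁, l₂, hl⟩ := List.append_of_mem hx
    have hlt : ∀ y ∈ l₂, x < y := by
      intro y hy
      have h1 : (l₁ ++ x :: l₂).Pairwise (· ≤ ·) := hl ▸ Finset.pairwise_sort _ _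
      have h2 : (l₁ ++ x :: l₂).Nodup := hl ▸ Finset.sort_nodup _ _
      rw [List.pairwise_append, List.pairwise_cons] at h1
      rw [List.nodup_append, List.nodup_cons] at h2
      exact lt_of_le_of_ne (h1.2.1.1 y hy) (fun h => h2.2.1.1 (h ▸ hy))
    -- Between `x` and `p` come exactly the subtrees at the larger siblings of `x`, as `x` ends its
    -- own postorder.
    refine ⟨l₂.flatMap (postorder r T), ?_, ?_⟩
    · rw [postorder_eq, hl]
      refine ⟨l₁.flatMap (postorder r T) ++
        ((badChildren r T x).sort).flatMap (postorder r T), [], ?_⟩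
      rw [List.flatMap_append, List.flatMap_cons, postorder_eq x]
      simp
    · intro b hb
      obtain ⟨y, hy, hby⟩ := List.mem_flatMap.1 hb
      exact (hlt y hy).trans_le (reflTransGen_badArc_le (mem_postorder.1 hby))
  | @tail w v _ hwv ih =>
    obtain ⟨B, hB, hlt⟩ := ih
    refine ⟨B, hB.trans ?_, hlt⟩
    rw [postorder_eq v]
    refine (List.infix_flatMap_of_mem ?_ _).trans (List.prefix_append _ _).isInfix
    rwa [Finset.mem_sort, mem_badChildren]

/-! ### The permutation `sigma` and the linear trees -/

theorem prod_formPerm_apply (hT : T.IsTree) {c x : V} (hc : IsIncreasingRoot r T c)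
    (hx : x ∈ postorder r T c) {l : List V} (hl : ∀ d ∈ l, IsIncreasingRoot r T d)
    (hn : l.Nodup) :
    (l.map fun v => (postorder r T v).formPerm).prod x =
      if c ∈ l then (postorder r T c).formPerm x else x := by
  have hout : ∀ {d y}, IsIncreasingRoot r T d → d ≠ c → y ∈ postorder r T c →
      (postorder r T d).formPerm y = y := by
    intro d y hd hdc hy
    refine List.formPerm_apply_of_notMem fun hyd => hdc ?_
    exact increasingRoot_unique hT hd hc (mem_postorder.1 hyd) (mem_postorder.1 hy)
  induction l with
  | nil => simp
  | cons d l ih =>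
    rw [List.nodup_cons] at hn
    have ih := ih (fun e he => hl e (List.mem_cons_of_mem _ he)) hn.2
    rw [List.map_cons, List.prod_cons, Equiv.Perm.mul_apply, ih]
    by_cases hdc : d = c
    · subst hdc
      simp [hn.1]
    · have hd := hl d List.mem_cons_self
      by_cases hcl : c ∈ l
      · simp [hcl, hout hd hdc (List.formPerm_apply_mem_of_mem hx)]
      · simp [hcl, hout hd hdc hx, Ne.symm hdc]

theorem sigma_apply (hT : T.IsTree) {c x : V} (hc : IsIncreasingRoot r T c)
    (hx : ReflTransGen (BadArc r T) x c) :
    sigma r T x = (postorder r T c).formPerm x := by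
  rw [sigma, prod_formPerm_apply hT hc (mem_postorder.2 hx) _ (Finset.sort_nodup _ _), if_pos]
  · simpa using hc
  · simp

/-- `σ` preserves the increasing trees. -/
theorem reflTransGen_sigma (hT : T.IsTree) {c x : V} (hc : IsIncreasingRoot r T c)
    (hx : ReflTransGen (BadArc r T) x c) : ReflTransGen (BadArc r T) (sigma r T x) c := by
  rw [sigma_apply hT hc hx, ← mem_postorder]
  exact List.formPerm_apply_mem_of_mem (mem_postorder.2 hx)

theorem LinearArc.eq_sigma (hT : T.IsTree) {i j : V} (h : LinearArc r T i j) :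
    j = sigma r T i := by
  obtain ⟨c, hc, A, B, hAB⟩ := h
  have hi : i ∈ postorder r T c := by rw [← hAB]; simp
  rw [sigma_apply hT hc (mem_postorder.1 hi)]
  have hn := nodup_postorder (r := r) hT c
  rw [← hAB] at hn ⊢
  have := List.formPerm_apply_lt_getElem _ hn A.length (by simp)
  simpa using this.symm

/-- An increasing root is the last entry of its postorder and occurs there only once, so nothing
follows it. -/
theorem LinearArc.not_isIncreasingRoot (hT : T.IsTree) {i j : V} (h : LinearArc r T i j) :
    ¬ IsIncreasingRoot r T i := by
  intro hi
  obtain ⟨c, hc, A, B, hAB⟩ := h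
  have hic : i ∈ postorder r T c := by rw [← hAB]; simp
  obtain rfl := eq_of_reflTransGen_badArc hT hi (mem_postorder.1 hic)
  have hn := nodup_postorder (r := r) hT i
  have hlast : (postorder r T i).getLast? = some i := by rw [postorder_eq]; simp
  rw [← hAB] at hn hlast
  have hn' : i ∉ j :: B := by
    have : (A ++ i :: j :: B).Nodup := by simpa using hn
    exact (List.nodup_cons.1 (List.nodup_append.1 this).2.1).1
  have : (j :: B).getLast? = some i := by
    rw [← hlast]
    simp [List.getLast?_append, List.getLast?_cons]
  exact hn' (List.mem_of_getLast? this)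

theorem linearArc_sigma (hT : T.IsTree) {i : V} (hi : ¬ IsIncreasingRoot r T i) :
    LinearArc r T i (sigma r T i) := by
  obtain ⟨c, hc, hic⟩ := exists_increasingRoot (r := r) hT i
  have hmem := mem_postorder.2 hic
  have hne : i ≠ c := fun h => hi (h ▸ hc)
  rw [postorder_eq] at hmem
  obtain ⟨A, B, hAB⟩ := List.append_of_mem (List.mem_append.1 hmem |>.resolve_right (by simpa))
  have key : ∃ j, LinearArc r T i j := by
    cases B with
    -- Here `i` is the last entry before the root `c`.
    | nil => exact ⟨c, c, hc, A, [], by rw [postorder_eq, hAB]; simp⟩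
    | cons j B => exact ⟨j, c, hc, A, B ++ [c], by rw [postorder_eq, hAB]; simp⟩
  obtain ⟨j, hj⟩ := key
  exact hj.eq_sigma hT ▸ hj

theorem linearArc_iff (hT : T.IsTree) {i j : V} :
    LinearArc r T i j ↔ ¬ IsIncreasingRoot r T i ∧ j = sigma r T i :=
  ⟨fun h => ⟨h.not_isIncreasingRoot hT, h.eq_sigma hT⟩,
    fun h => h.2 ▸ linearArc_sigma hT h.1⟩

theorem isChain_postorder {c : V} (hc : IsIncreasingRoot r T c) :
    (postorder r T c).IsChain (LinearArc r T) := by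
  rw [List.isChain_iff_forall_rel_of_append_cons_cons]
  intro a b l₁ l₂ h
  exact ⟨c, hc, l₁, l₂, by simp [h]⟩

/-- Every vertex of an increasing tree reaches the root along the linear tree. -/
theorem reflTransGen_linearArc {c x : V} (hc : IsIncreasingRoot r T c)
    (hx : ReflTransGen (BadArc r T) x c) : ReflTransGen (LinearArc r T) x c := by
  have hmem := mem_postorder.2 hx
  have hch := isChain_postorder hc
  rw [postorder_eq] at hmem hch
  generalize ((badChildren r T c).sort).flatMap (postorder r T) = l at hmem hch
  clear hx hc
  induction l generalizing x with
  | nil => rw [List.mem_singleton.1 hmem]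
  | cons a l ih =>
    rw [List.cons_append] at hmem hch
    rcases List.mem_cons.1 hmem with rfl | h
    · cases l with
      | nil => exact .single (List.isChain_cons_cons.1 hch).1
      | cons b l =>
        have := List.isChain_cons_cons.1 hch
        exact (ih List.mem_cons_self this.2).head this.1
    · exact ih h hch.tail

/-- If `x` is not the root of its increasing tree, the parent of `x` is the first vertex smaller
than `x` on the `σ`-orbit of `x`. -/
theorem exists_iterate_sigma (hT : T.IsTree) {x p : V} (hxp : BadArc r T x p) :
    ∃ k, (sigma r T)^[k] x = p ∧ ∀ m < k, x ≤ (sigma r T)^[m] x := by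
  obtain ⟨c, hc, hpc⟩ := exists_increasingRoot (r := r) hT p
  obtain ⟨B, hB, hlt⟩ := exists_infix_postorder hxp hpc
  have hch := (isChain_postorder hc).infix hB
  -- Linear arcs are `sigma`-steps, so the stretch of postorder from `x` to `p` is a stretch of the
  -- orbit.
  have hit : ∀ (B : List V) (a : V), (a :: B ++ [p]).IsChain (LinearArc r T) →
      (sigma r T)^[B.length + 1] a = p ∧
        ∀ m < B.length + 1, (sigma r T)^[m] a ∈ a :: B := by
    intro B
    induction B with
    | nil =>
      intro a h
      simp only [List.cons_append, List.nil_append, List.isChain_cons_cons] at h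
      simpa using (h.1.eq_sigma hT).symm
    | cons b B ih =>
      intro a h
      simp only [List.cons_append, List.isChain_cons_cons] at h
      obtain ⟨h1, h2⟩ := ih b h.2
      have hb := h.1.eq_sigma hT
      refine ⟨by rw [List.length_cons, Function.iterate_succ_apply, ← hb, h1], ?_⟩
      rintro (_ | m) hm
      · simp
      · rw [Function.iterate_succ_apply, ← hb]
        exact List.mem_cons_of_mem _ (h2 m (by simpa using hm))
  obtain ⟨h1, h2⟩ := hit B x hch
  refine ⟨_, h1, fun m hm => ?_⟩
  rcases List.mem_cons.1 (h2 m hm) with h | h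
  · exact h.ge
  · exact (hlt _ h).le

end Postorder

/-! ### The tree `Phi r T`, its sibships and indegrees -/

section Phi

open Relation

variable {V : Type*} [LinearOrder V] [Fintype V] {r : V} {T : SimpleGraph V}

theorem reflTransGen_phiArc (hT : T.IsTree) (v : V) :
    ReflTransGen (fun i j => LinearArc r T i j ∨ MovedArc r T i j) v r := by
  have hlin : ∀ {x c : V}, IsIncreasingRoot r T c → ReflTransGen (BadArc r T) x c →
      ReflTransGen (fun i j => LinearArc r T i j ∨ MovedArc r T i j) x c := fun hc hx =>
    ReflTransGen.mono (fun _ _ => Or.inl) _ _ (reflTransGen_linearArc hc hx)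
  have hroot : ∀ n c, IsIncreasingRoot r T c → T.dist c r = n →
      ReflTransGen (fun i j => LinearArc r T i j ∨ MovedArc r T i j) c r := by
    intro n
    induction n using Nat.strong_induction_on with
    | _ n ih =>
      rintro c (rfl | ⟨k, hk⟩) hd
      · exact .refl
      · obtain ⟨d, hd', hkd⟩ := exists_increasingRoot (r := r) hT k
        have h1 : T.dist c r = T.dist k r + 1 := hk.1.2
        have h2 := reflTransGen_badArc_dist_le hkd
        -- The moved arc lands in the increasing tree of `k`, whose root `d` is strictly nearer to
        -- `r` than `c`.
        exact ((hlin hd' (reflTransGen_sigma hT hd' hkd)).trans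
          (ih _ (by omega) d hd' rfl)).head (.inr ⟨k, hk, rfl⟩)
  obtain ⟨c, hc, hvc⟩ := exists_increasingRoot (r := r) hT v
  exact (hlin hc hvc).trans (hroot _ c hc rfl)

/-- Linear arcs leave non-roots of increasing trees and moved arcs leave roots other than `r`, so
the two kinds never compete for a source. -/
theorem isTree_phi (hT : T.IsTree) :
    (Phi r T).graph.IsTree ∧
      ∀ i j, GloArc (Phi r T) i j ↔ LinearArc r T i j ∨ MovedArc r T i j := by
  refine isTree_fromRel ?_ ?_ (reflTransGen_phiArc hT)
  · rintro j (h | ⟨k, hk, -⟩)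
    · exact h.not_isIncreasingRoot hT (.inl rfl)
    · exact hk.1.ne_root rfl
  · rintro i j k (hj | ⟨j', hj, rfl⟩) (hk | ⟨k', hk, rfl⟩)
    · rw [hj.eq_sigma hT, hk.eq_sigma hT]
    · exact absurd (.inr ⟨_, hk⟩) (hj.not_isIncreasingRoot hT)
    · exact absurd (.inr ⟨_, hj⟩) (hk.not_isIncreasingRoot hT)
    · rw [hj.unique hT hk]

theorem gloArc_phi (hT : T.IsTree) {i j : V} :
    GloArc (Phi r T) i j ↔
      (¬ IsIncreasingRoot r T i ∧ j = sigma r T i) ∨ ∃ k, GoodArc r T i k ∧ j = sigma r T k := by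
  rw [(isTree_phi hT).2, linearArc_iff hT]
  rfl

theorem gloArc_phi_sigma (hT : T.IsTree) {k v : V} :
    GloArc (Phi r T) k (sigma r T v) ↔
      GoodArc r T k v ∨ (k = v ∧ ¬ IsIncreasingRoot r T v) := by
  rw [gloArc_phi hT]
  constructor
  · rintro (⟨hk, h⟩ | ⟨w, hw, h⟩)
    · rw [(sigma r T).injective h]
      exact .inr ⟨rfl, hk⟩
    · rw [(sigma r T).injective h]
      exact .inl hw
  · rintro (h | ⟨rfl, h⟩)
    · exact .inr ⟨v, h, rfl⟩
    · exact .inl ⟨h, rfl⟩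

theorem sibshipLoc_eq_sibshipGlo (hT : T.IsTree) (v : V) :
    sibshipLoc r T v = sibshipGlo (Phi r T) (sigma r T v) := by
  ext k
  rw [mem_sibshipLoc hT, sibshipGlo_eq_childGroup]
  exact (gloArc_phi_sigma hT).symm

theorem phiLoc_eq_phiGlo (hT : T.IsTree) : phiLoc r T = phiGlo (Phi r T) := by
  ext B
  refine and_congr_right fun _ => ?_
  simp only [sibshipLoc_eq_sibshipGlo hT, sibshipGlo_eq_childGroup]
  exact ((sigma r T).surjective.exists (p := fun w => B = childGroup (Phi r T) w)).symm

theorem indegree_locArc (hT : T.IsTree) (v : V) :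
    indegree (LocArc T) v = indegree (GloArc (Phi r T)) (sigma r T v) := by
  have hsplit : ∀ w, LocArc T w v ↔ GoodArc r T w v ∨ BadArc r T v w := by
    intro w
    refine ⟨fun h => ?_, fun h => h.elim (·.2) (·.2)⟩
    exact ((adj_iff_gloArc (T := ⟨T, r⟩) hT).1 h.1).imp (fun h' => ⟨h', h⟩) (fun h' => ⟨h', h⟩)
  simp only [indegree, hsplit, gloArc_phi_sigma hT]
  by_cases hv : IsIncreasingRoot r T v
  · have : ∀ w, ¬ BadArc r T v w := fun w hw => hw.not_isIncreasingRoot hT hv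
    simp [hv, this]
  · obtain ⟨p, hp⟩ := exists_badArc hT hv
    -- Besides the good children, the local arcs into `v` have the source `p`, the arcs into `sigma
    -- r T v` the source `v`: one extra each.
    have h1 : {w | GoodArc r T w v ∨ BadArc r T v w} = insert p {w | GoodArc r T w v} := by
      ext w
      simp only [Set.mem_ofPred_eq, Set.mem_insert_iff, or_comm (a := w = p)]
      exact or_congr_right ⟨fun h => h.unique hT hp, fun h => h ▸ hp⟩
    have h2 : {w | GoodArc r T w v ∨ (w = v ∧ ¬ IsIncreasingRoot r T v)} =
        insert v {w | GoodArc r T w v} := by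
      ext w
      simp [hv, or_comm]
    rw [h1, h2, Set.ncard_insert_of_notMem _ (Set.toFinite _),
      Set.ncard_insert_of_notMem _ (Set.toFinite _)]
    · exact fun h => lt_irrefl _ (GoodArc.lt h)
    · exact fun h : GoodArc r T p v => hp.1.asymm h.1

theorem indegreeSeq_locArc (hT : T.IsTree) :
    indegreeSeq (LocArc T) = indegreeSeq (GloArc (Phi r T)) := by
  have : indegree (LocArc T) = indegree (GloArc (Phi r T)) ∘ sigma r T :=
    funext (indegree_locArc hT)
  rw [indegreeSeq, indegreeSeq, this, ← Multiset.map_map, Multiset.map_univ_val_equiv]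

/-! ### Recovering `T` from its image -/

/-- The vertices that are not roots of increasing trees can be read off from `Phi r T`. -/
theorem not_isIncreasingRoot_iff (hT : T.IsTree) {v u c : V} (hvu : GloArc (Phi r T) v u)
    (hc : IsIncreasingRoot r T c) (huc : ReflTransGen (BadArc r T) u c) :
    ¬ IsIncreasingRoot r T v ↔ c < v ∧ ∀ w, GloArc (Phi r T) w u → w ≤ v := by
  constructor
  · intro hv
    obtain rfl : u = sigma r T v := by
      rcases (gloArc_phi hT).1 hvu with h | ⟨k, hk, -⟩
      · exact h.2
      · exact absurd (.inr ⟨k, hk⟩) hv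
    obtain ⟨d, hd, hvd⟩ := exists_increasingRoot (r := r) hT v
    obtain rfl := increasingRoot_unique hT hc hd huc (reflTransGen_sigma hT hd hvd)
    refine ⟨lt_of_le_of_ne (reflTransGen_badArc_le hvd) fun h => hv (h ▸ hc), fun w hw => ?_⟩
    rcases (gloArc_phi_sigma hT).1 hw with h | h
    · exact h.lt.le
    · exact h.1.le
  · rintro ⟨hcv, hmax⟩ hv
    rcases (gloArc_phi hT).1 hvu with h | ⟨x, hx, rfl⟩
    · exact h.1 hv
    · by_cases hxr : IsIncreasingRoot r T x
      · obtain rfl := increasingRoot_unique hT hc hxr huc (reflTransGen_sigma hT hxr .refl)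
        exact lt_asymm hcv hx.lt
      · exact (hmax x ((gloArc_phi_sigma hT).2 (.inr ⟨rfl, hxr⟩))).not_gt hx.lt

variable {T' : SimpleGraph V}

/-- The test in `not_isIncreasingRoot_iff` uses only the image and the root `c` already known for
the parent, so induction outward from `r` applies. -/
theorem exists_common_increasingRoot (hT : T.IsTree) (hT' : T'.IsTree)
    (h : Phi r T = Phi r T') (v : V) :
    (IsIncreasingRoot r T v ↔ IsIncreasingRoot r T' v) ∧
      ∃ c, (IsIncreasingRoot r T c ∧ ReflTransGen (BadArc r T) v c) ∧
        (IsIncreasingRoot r T' c ∧ ReflTransGen (BadArc r T') v c) := by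
  induction reflTransGen_phiArc hT v using ReflTransGen.head_induction_on with
  | refl => exact ⟨iff_of_true (.inl rfl) (.inl rfl), r, ⟨.inl rfl, .refl⟩, .inl rfl, .refl⟩
  | @head v u hvu _ ih =>
    obtain ⟨-, c, ⟨hc, huc⟩, hc', huc'⟩ := ih
    have hvu : GloArc (Phi r T) v u := ((isTree_phi hT).2 v u).2 hvu
    have hvu' := h ▸ hvu
    have hiff : IsIncreasingRoot r T v ↔ IsIncreasingRoot r T' v := by
      rw [← not_iff_not, not_isIncreasingRoot_iff hT hvu hc huc,
        not_isIncreasingRoot_iff hT' hvu' hc' huc', h]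
    refine ⟨hiff, ?_⟩
    by_cases hv : IsIncreasingRoot r T v
    · exact ⟨v, ⟨hv, .refl⟩, hiff.1 hv, .refl⟩
    · have key : ∀ {S : SimpleGraph V}, S.IsTree → GloArc (Phi r S) v u →
          ¬ IsIncreasingRoot r S v → IsIncreasingRoot r S c →
          ReflTransGen (BadArc r S) u c → ReflTransGen (BadArc r S) v c := by
        intro S hS hvu hv hc huc
        obtain ⟨d, hd, hvd⟩ := exists_increasingRoot (r := r) hS v
        rcases (gloArc_phi hS).1 hvu with ⟨-, rfl⟩ | ⟨k, hk, -⟩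
        · exact increasingRoot_unique hS hc hd huc (reflTransGen_sigma hS hd hvd) ▸ hvd
        · exact absurd (.inr ⟨k, hk⟩) hv
      exact ⟨c, ⟨hc, key hT hvu hv hc huc⟩, hc', key hT' hvu' (hiff.not.1 hv) hc' huc'⟩

theorem isIncreasingRoot_congr (hT : T.IsTree) (hT' : T'.IsTree) (h : Phi r T = Phi r T')
    {v : V} : IsIncreasingRoot r T v ↔ IsIncreasingRoot r T' v :=
  (exists_common_increasingRoot hT hT' h v).1

theorem reflTransGen_badArc_congr (hT : T.IsTree) (hT' : T'.IsTree) (h : Phi r T = Phi r T')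
    {v c : V} (hc : IsIncreasingRoot r T c) (hvc : ReflTransGen (BadArc r T) v c) :
    ReflTransGen (BadArc r T') v c := by
  obtain ⟨-, d, ⟨hd, hvd⟩, -, hvd'⟩ := exists_common_increasingRoot hT hT' h v
  rwa [increasingRoot_unique hT hc hd hvc hvd]

/-- On a non-root, `sigma` is the parent in the image. Each increasing tree has one further vertex,
its root, and bijectivity leaves one value for it. -/
theorem sigma_eq_of_phi_eq (hT : T.IsTree) (hT' : T'.IsTree) (h : Phi r T = Phi r T') :
    sigma r T = sigma r T' := by
  have hbad : ∀ v, ¬ IsIncreasingRoot r T v → sigma r T v = sigma r T' v := by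
    intro v hv
    have hv' := (isIncreasingRoot_congr hT hT' h).not.1 hv
    have h1 := (gloArc_phi_sigma hT).2 (.inr ⟨rfl, hv⟩)
    have h2 := (gloArc_phi_sigma hT').2 (.inr ⟨rfl, hv'⟩)
    rw [← h] at h2
    exact h1.parent_unique (isTree_phi hT).1 h2
  ext v
  by_cases hv : IsIncreasingRoot r T v
  · have hv' := (isIncreasingRoot_congr hT hT' h).1 hv
    obtain ⟨y, hy⟩ := (sigma r T').surjective (sigma r T v)
    obtain ⟨d, ⟨hd, hyd⟩, hd', hyd'⟩ := (exists_common_increasingRoot hT hT' h y).2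
    have h1 := reflTransGen_badArc_congr hT hT' h hv (reflTransGen_sigma hT hv .refl)
    have h2 := reflTransGen_sigma hT' hd' hyd'
    rw [hy] at h2
    obtain rfl := increasingRoot_unique hT' hv' hd' h1 h2
    by_cases hyr : IsIncreasingRoot r T y
    · obtain rfl := eq_of_reflTransGen_badArc hT hyr hyd
      exact hy.symm
    · have := hbad y hyr
      rw [hy] at this
      rw [← (sigma r T).injective this, hy, (sigma r T).injective this]
  · exact hbad v hv

theorem badArc_of_phi_eq (hT : T.IsTree) (hT' : T'.IsTree) (h : Phi r T = Phi r T') {v p : V}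
    (hp : BadArc r T v p) : BadArc r T' v p := by
  have hv' := (isIncreasingRoot_congr hT hT' h).not.1 (hp.not_isIncreasingRoot hT)
  obtain ⟨p', hp'⟩ := exists_badArc hT' hv'
  obtain ⟨k, hk, hlt⟩ := exists_iterate_sigma hT hp
  obtain ⟨k', hk', hlt'⟩ := exists_iterate_sigma hT' hp'
  rw [← sigma_eq_of_phi_eq hT hT' h] at hk' hlt'
  -- Both are the first vertex below `v` on the same orbit.
  obtain rfl : p = p' := by
    rcases lt_trichotomy k k' with hkk | rfl | hkk
    · exact absurd hp.lt (hk ▸ hlt' k hkk).not_gt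
    · exact hk.symm.trans hk'
    · exact absurd hp'.lt (hk' ▸ hlt k' hkk).not_gt
  exact hp'

theorem gloArc_of_phi_eq (hT : T.IsTree) (hT' : T'.IsTree) (h : Phi r T = Phi r T') {v p : V}
    (hp : GloArc ⟨T, r⟩ v p) : GloArc ⟨T', r⟩ v p := by
  by_cases hv : IsIncreasingRoot r T v
  · rcases hv with rfl | ⟨q, hq⟩
    · exact absurd rfl hp.ne_root
    · obtain rfl := GloArc.parent_unique (T := ⟨T, r⟩) hT hp hq.1
      have h1 := (gloArc_phi_sigma hT).2 (.inl hq)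
      -- A child of `sigma r T' p` in the image other than `p` must be a good child of `p`.
      rw [h, sigma_eq_of_phi_eq hT hT' h, gloArc_phi_sigma hT'] at h1
      rcases h1 with h1 | h1
      · exact h1.1
      · exact absurd h1.1 hq.lt.ne
  · obtain ⟨q, hq⟩ := exists_badArc hT hv
    obtain rfl := GloArc.parent_unique (T := ⟨T, r⟩) hT hp hq.1
    exact (badArc_of_phi_eq hT hT' h hq).1

theorem injOn_phi (r : V) : Set.InjOn (Phi r) (labeledTrees V) := by
  intro T hT T' hT' h
  ext i j
  exact (adj_iff_gloArc (T := ⟨T, r⟩) hT).trans <| Iff.trans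
    ⟨Or.imp (gloArc_of_phi_eq hT hT' h) (gloArc_of_phi_eq hT hT' h),
      Or.imp (gloArc_of_phi_eq hT' hT h.symm) (gloArc_of_phi_eq hT' hT h.symm)⟩
    (adj_iff_gloArc (T := ⟨T', r⟩) hT').symm

theorem mapsTo_phi (r : V) : Set.MapsTo (Phi r) (labeledTrees V) (rootedTrees r) :=
  fun _ hT => ⟨(isTree_phi hT).1, rfl⟩

theorem bijOn_phi (r : V) : Set.BijOn (Phi r) (labeledTrees V) (rootedTrees r) := by
  refine ⟨mapsTo_phi r, injOn_phi r, ?_⟩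
  have hfin : (rootedTrees r).Finite := by
    rw [rootedTrees_eq_image]
    exact (Set.toFinite _).image _
  have himage : Phi r '' labeledTrees V = rootedTrees r := by
    -- An injective image has as many elements as there are labeled trees, and attaching the root
    -- `r` yields no more rooted ones.
    refine Set.eq_of_subset_of_ncard_le (mapsTo_phi r).image_subset ?_ hfin
    rw [(injOn_phi r).ncard_image, rootedTrees_eq_image]
    exact Set.ncard_image_le (Set.toFinite _)
  exact himage.ge

end Phi

end TreeBijection

open TreeBijection in
theorem mainTheorem2 (n : ℕ) (r : Fin n) :
    Set.BijOn (Phi r) (labeledTrees (Fin n)) (rootedTrees r) ∧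
    (∀ T ∈ labeledTrees (Fin n),
      indegreeSeq (LocArc T) = indegreeSeq (GloArc (Phi r T))) ∧
    (∀ lam : (n - 1).Partition,
      Set.BijOn (Phi r) (labeledTreesOfType lam) (rootedTreesOfType r lam)) ∧
    (∀ T ∈ labeledTrees (Fin n),
      (∀ v, sibshipLoc r T v = sibshipGlo (Phi r T) (sigma r T v)) ∧
      phiLoc r T = phiGlo (Phi r T)) := by
  refine ⟨bijOn_phi r, fun T hT => indegreeSeq_locArc hT, fun lam => ⟨?_, ?_, ?_⟩,
    fun T hT => ⟨sibshipLoc_eq_sibshipGlo hT, phiLoc_eq_phiGlo hT⟩⟩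
  · exact fun T hT => ⟨mapsTo_phi r hT.1, (indegreeSeq_locArc hT.1).symm.trans hT.2⟩
  · exact (injOn_phi r).mono fun T hT => hT.1
  · rintro G ⟨hG, hlam⟩
    obtain ⟨T, hT, rfl⟩ := (bijOn_phi r).surjOn hG
    exact ⟨T, ⟨hT, (indegreeSeq_locArc hT).trans hlam⟩, rfl⟩
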